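/- **Notation.** Inequalities $\preceq,\prec$ (and $\succeq,\succ$), absolute values, maxima and limits of vectors and matrices are componentwise ($x\prec y$ means $x_j<y_j$ for every $j$); $\mathbb{R}^m_{+0}$ is the set of nonnegative vectors in $\mathbb{R}^m$. A function $f:\mathbb{R}^n_{+0}\to\mathbb{R}^m_{+0}$ is called CNI if $0\preceq x_1\preceq x_2$ implies $f(x_1)\preceq f(x_2)$. A real square matrix is Hurwitz if all its eigenvalues have negative real part. For $B\in\mathbb{C}^{n\times n}$, $\mathcal{M}(B)\in\mathbb{R}^{n\times n}$ has entries $\operatorname{Re}B_{j,j}$ on the diagonal and $|B_{j,l}|$ for $j\ne l$. **System.** Let $n,N\ge 1$, $\bar\tau\ge 0$, and for $i\in\{1,\dots,N\}$ let $A_i\in\mathbb{R}^{n\times n}$, $H_i\in\mathbb{R}^{n\times k_i}$, and let $\delta_i:\mathbb{R}^n_{+0}\to\mathbb{R}^{k_i}_{+0}$ be continuous and CNI. A trajectory is a function $x:[-\bar\tau,\infty)\to\mathbb{R}^n$ that is continuous, locally absolutely continuous on $[0,\infty)$, and satisfies $$\dot x(t)=A_{\sigma(t)}x(t)+H_{\sigma(t)}w_{\sigma(t)}(t)\quad\text{for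 almost every } t\ge 0,$$ for some switching function $\sigma$ with values in $\{1,\dots,N\}$ and some perturbations $w_i(t)\in\mathbb{R}^{k_i}$ with $$|w_i(t)|\preceq\delta_i(\theta(t))\ \text{ for all } t\ge 0 \text{ and all } i,\qquad \theta(t)=\max_{t-\bar\tau\le s\le t}|x(s)|.$$ **Theorem.** Let $V\in\mathbb{C}^{n\times n}$ be invertible and suppose that $\Lambda=\max_i\mathcal{M}(V^{-1}A_iV)$ is Hurwitz. Let $$\psi(x)=\max_i\ \max_{w\in\mathbb{R}^{k_i},\,|w|\preceq\delta_i(|V|x)}|V^{-1}H_iw| ,$$ let $\delta:\mathbb{R}^n_{+0}\to\mathbb{R}^n_{+0}$ be continuous and CNI with $\delta(x)\succeq\psi(x)$ for all $x\in\mathbb{R}^n_{+0}$, and for $\gamma\in\mathbb{R}^n_{+0}$ let $T_\gamma(x)=-\Lambda^{-1}\delta(x)+\gamma$. Let $\beta\in\mathbb{R}^n_{+0}$ satisfy $T_0(\beta)\prec\beta$. Then every $T_\gamma$, $\gamma\in\mathbb{R}^n_{+0}$, maps $\mathbb{R}^n_{+0}$ into itself, and: (a) $T_0^{k+1}(\beta)\preceq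 T_0^k(\beta)$ for every integer $k\ge 0$, and $\lim_{k\to\infty}T_0^k(\beta)=b$ for some $b\succeq 0$. (b) Let $\gamma\in\mathbb{R}^n_{+0}$ satisfy $-\Lambda^{-1}\big[\delta(\beta)+\max\{-\Lambda\gamma,0\}\big]\prec\beta$. If a trajectory satisfies $|V^{-1}x(t)|\preceq T_\gamma(\beta)$ for all $-\bar\tau\le t\le 0$, then $|V^{-1}x(t)|\preceq\beta$ for all $t\ge-\bar\tau$. (c) For every $c\in\mathbb{R}^n$ with $c\succ 0$ let $p(c)=\max\{-\Lambda c,0\}$. Then $p(c)\ne 0$, the set $\{j:[-\Lambda^{-1}p(c)]_j\ne 0\}$ is nonempty, $$\bar\epsilon=\min_{j:\,[-\Lambda^{-1}p(c)]_j\neq 0}\ \frac{[\beta+\Lambda^{-1}\delta(\beta)]_j}{[-\Lambda^{-1}p(c)]_j}>0,$$ and for every $0<\epsilon<\bar\epsilon$ the vector $\gamma=\epsilon c$ satisfies $-\Lambda^{-1}\big[\delta(\beta)+\max\{-\Lambda\gamma,0\}\big]\prec\beta$. (d) If a trajectory satisfies $|V^{-1}x(t)|\preceq\beta$ for all $t\ge-\bar\tau$,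 then $\limsup_{t\to\infty}|V^{-1}x(t)|\preceq b$, with $b$ as in (a). -/

import Mathlib

open Set Filter Topology MeasureTheory
open scoped Matrix

noncomputable section

namespace SwitchingSystem

/-- The nonnegative orthant of `ℝ^m`, with the componentwise order. -/
abbrev orthant (m : ℕ) : Set (Fin m → ℝ) := Set.Ici 0

/-- Componentwise monotone functions from a nonnegative orthant to a nonnegative orthant.
Values outside the orthant are irrelevant. -/
structure IsCNI {n m : ℕ} (f : (Fin n → ℝ) → (Fin m → ℝ)) : Prop where
  mapsTo : MapsTo f (orthant n) (orthant m)
  monotoneOn : MonotoneOn f (orthant n)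

/-- All (complex) eigenvalues of the real matrix `L` have negative real part. -/
def IsHurwitz {n : ℕ} (L : Matrix (Fin n) (Fin n) ℝ) : Prop :=
  ∀ μ ∈ spectrum ℂ (L.map Complex.ofReal), μ.re < 0

/-- The operation `M(·)`: real parts on the diagonal, moduli off the diagonal. -/
def metzlerPart {n : ℕ} (B : Matrix (Fin n) (Fin n) ℂ) : Matrix (Fin n) (Fin n) ℝ :=
  Matrix.of fun j l => if j = l then (B j l).re else ‖B j l‖

/-- `Λ`, the entrywise maximum over `i` of `M(V⁻¹ A_i V)`. -/
def lamMat {n N : ℕ} [NeZero N] (V : Matrix (Fin n) (Fin n) ℂ)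
    (A : Fin N → Matrix (Fin n) (Fin n) ℝ) : Matrix (Fin n) (Fin n) ℝ :=
  Matrix.of fun j l => Finset.univ.sup' Finset.univ_nonempty
    fun i => metzlerPart (V⁻¹ * (A i).map Complex.ofReal * V) j l

/-- The vector of moduli `|B v|`, for a complex matrix `B` and a real vector `v`. -/
def absMulVec {n m : ℕ} (B : Matrix (Fin n) (Fin m) ℂ) (v : Fin m → ℝ) : Fin n → ℝ :=
  fun j => ‖(B *ᵥ fun l => (v l : ℂ)) j‖

/-- The matrix of moduli `|B|`. -/
def absMat {n m : ℕ} (B : Matrix (Fin n) (Fin m) ℂ) : Matrix (Fin n) (Fin m) ℝ :=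
  B.map fun z => ‖z‖

/-- `ψ(x) = max_i max_{|w| ⪯ δ_i(|V| x)} |V⁻¹ H_i w|`, componentwise. -/
def psi {n N : ℕ} [NeZero N] {k : Fin N → ℕ} (V : Matrix (Fin n) (Fin n) ℂ)
    (H : ∀ i, Matrix (Fin n) (Fin (k i)) ℝ)
    (dl : ∀ i, (Fin n → ℝ) → (Fin (k i) → ℝ)) (x : Fin n → ℝ) : Fin n → ℝ :=
  fun j => Finset.univ.sup' Finset.univ_nonempty fun i =>
    sSup ((fun w : Fin (k i) → ℝ => absMulVec (V⁻¹ * (H i).map Complex.ofReal) w j) ''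
      {w | |w| ≤ dl i (absMat V *ᵥ x)})

/-- `T_γ(x) = -Λ⁻¹ δ(x) + γ`. -/
def tMap {n : ℕ} (L : Matrix (Fin n) (Fin n) ℝ) (δ : (Fin n → ℝ) → (Fin n → ℝ))
    (γ x : Fin n → ℝ) : Fin n → ℝ :=
  -(L⁻¹ *ᵥ δ x) + γ

/-- `θ(t)`, the componentwise maximum of `|x(s)|` over `t - τ ≤ s ≤ t`. -/
def delayMax {n : ℕ} (τ : ℝ) (x : ℝ → Fin n → ℝ) (t : ℝ) : Fin n → ℝ :=
  fun j => sSup ((fun s => |x s j|) '' Icc (t - τ) t)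

/-- `x` is a trajectory on `[-τ, ∞)` of `x' = A_σ x + H_σ w_σ` (in the sense of Carathéodory, which
contains the classical and the piecewise classical sense) for the switching function `σ` and the
perturbations `w`, and the perturbations obey `|w_i(t)| ⪯ δ_i(θ(t))` for `t ≥ 0`. -/
structure IsTrajectory {n N : ℕ} {k : Fin N → ℕ}
    (A : Fin N → Matrix (Fin n) (Fin n) ℝ) (H : ∀ i, Matrix (Fin n) (Fin (k i)) ℝ)
    (dl : ∀ i, (Fin n → ℝ) → (Fin (k i) → ℝ)) (τ : ℝ)
    (σ : ℝ → Fin N) (w : ∀ i, ℝ → Fin (k i) → ℝ) (x : ℝ → Fin n → ℝ) : Prop where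
  continuousOn : ContinuousOn x (Ici (-τ))
  absolutelyContinuous : ∀ t, 0 ≤ t → AbsolutelyContinuousOnInterval x 0 t
  ode : ∀ᵐ t : ℝ, 0 ≤ t →
    HasDerivAt x (A (σ t) *ᵥ x t + H (σ t) *ᵥ w (σ t) t) t
  bound : ∀ t, 0 ≤ t → ∀ i, |w i t| ≤ dl i (delayMax τ x t)

/-- The vector `p(c) = max {-Λ c, 0}`. -/
def pVec {n : ℕ} (L : Matrix (Fin n) (Fin n) ℝ) (c : Fin n → ℝ) : Fin n → ℝ :=
  fun j => if 0 < (-(L *ᵥ c)) j then (-(L *ᵥ c)) j else 0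

/-- The indices `j` with `[-Λ⁻¹ p(c)]_j ≠ 0`. -/
def pSupport {n : ℕ} (L : Matrix (Fin n) (Fin n) ℝ) (c : Fin n → ℝ) : Finset (Fin n) :=
  Finset.univ.filter fun j => (-(L⁻¹ *ᵥ pVec L c)) j ≠ 0

/-- The bound `ε̄`, a minimum over a nonempty finite index set. -/
def epsBar {n : ℕ} (L : Matrix (Fin n) (Fin n) ℝ) (δ : (Fin n → ℝ) → (Fin n → ℝ))
    (β c : Fin n → ℝ) (h : (pSupport L c).Nonempty) : ℝ :=
  (pSupport L c).inf' h fun j => (β + L⁻¹ *ᵥ δ β) j / (-(L⁻¹ *ᵥ pVec L c)) j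

/-- The condition `-Λ⁻¹ [δ(β) + max {-Λ γ, 0}] ≺ β` on `γ`. -/
def Admissible {n : ℕ} (L : Matrix (Fin n) (Fin n) ℝ) (δ : (Fin n → ℝ) → (Fin n → ℝ))
    (β γ : Fin n → ℝ) : Prop :=
  StrongLT (-(L⁻¹ *ᵥ (δ β + (-(L *ᵥ γ)) ⊔ 0))) β

end SwitchingSystem

end

namespace SwitchingSystem

/-! In the coordinates `z = V⁻¹ x` the moduli formally satisfy `|z|' ≤ Λ|z| + δ(ζ)` as long as `|z|
≤ ζ` on the delay window. Since `Λ` is Metzler and Hurwitz, there is a positive `v` with `Λ v = -1`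
(`IsHurwitz.exists_strongLT_mulVec_eq`), and `-Λ⁻¹` preserves nonnegativity. Hence `T_γ` is
monotone, which gives (a); (c) is linear algebra with the same facts.

For (b) and (d), fix a constant supersolution `η`, meaning `Λ η + δ(ζ) ≤ 0`, and measure how far
`|z|` exceeds `η` by one scalar, a sup norm weighted by `v`. If `Λ v ≤ -r v`, its derivative is at
most `-r` times itself wherever it exists (`IsTrajectory.deriv_excess_le`), and absolute continuity
integrates this (`IsTrajectory.exp_mul_excess_le`).

With `r = 0` an excess that starts at zero stays zero; strictness `η ≺ ζ` then closes a continuity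
argument, and `η = -Λ⁻¹[δ(β) + max{-Λγ, 0}]`, `ζ = β` gives (b). With `r > 0` the excess decays, so
an asymptotic bound `ζ` improves to `T₀(ζ)`; iterating from `β` gives (d). -/

variable {n N : ℕ}

/-! ### Metzler and Hurwitz matrices: sign of the inverse. -/

/-- A real matrix is Metzler if its off-diagonal entries are nonnegative. -/
def IsMetzler (L : Matrix (Fin n) (Fin n) ℝ) : Prop := ∀ j l, j ≠ l → 0 ≤ L j l

/-- Only the diagonal entry of row `j` may be negative, and it multiplies the coordinate where `a`
and `b` agree. This is the comparison used at every touching point below. -/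
theorem IsMetzler.mulVec_apply_le {L : Matrix (Fin n) (Fin n) ℝ} (hL : IsMetzler L)
    {a b : Fin n → ℝ} (hab : a ≤ b) {j : Fin n} (hj : a j = b j) :
    (L *ᵥ a) j ≤ (L *ᵥ b) j := by
  simp only [Matrix.mulVec, dotProduct]
  refine Finset.sum_le_sum fun l _ => ?_
  by_cases h : j = l
  · subst h; rw [hj]
  · exact mul_le_mul_of_nonneg_left (hab l) (hL j l h)

/-- A Metzler matrix that maps some positive vector to a negative one is inverse-nonpositive. -/
theorem IsMetzler.nonneg_of_mulVec_nonpos {L : Matrix (Fin n) (Fin n) ℝ} (hL : IsMetzler L)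
    {v u : Fin n → ℝ} (hv : StrongLT 0 v) (hLv : StrongLT (L *ᵥ v) 0) (hu : L *ᵥ u ≤ 0) :
    0 ≤ u := by
  intro i
  -- At the index of least ratio, the multiple `(u j / v j) • v` touches `u` from below. A negative
  -- ratio would make `(L u) j` positive.
  obtain ⟨j, -, hj⟩ := Finset.exists_min_image Finset.univ (fun j => u j / v j)
    ⟨i, Finset.mem_univ i⟩
  have hvj : 0 < v j := hv j
  by_cases hr : 0 ≤ u j / v j
  · have h := hr.trans (hj i (Finset.mem_univ i))
    have hvi : 0 < v i := hv i
    simpa using (le_div_iff₀ hvi).1 h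
  · exfalso
    push Not at hr
    have h := hL.mulVec_apply_le (a := (u j / v j) • v) (b := u) (j := j)
      (fun l => by
        have hvl : 0 < v l := hv l
        simpa using (le_div_iff₀ hvl).1 (hj l (Finset.mem_univ l)))
      (by simp [hvj.ne'])
    rw [Matrix.mulVec_smul] at h
    have h1 : (L *ᵥ v) j < 0 := hLv j
    have h2 : (L *ᵥ u) j ≤ 0 := hu j
    have := mul_pos_of_neg_of_neg hr h1
    simp only [Pi.smul_apply, smul_eq_mul] at h
    linarith

theorem IsHurwitz.isUnit_det_smul_one_sub {L : Matrix (Fin n) (Fin n) ℝ} (h : IsHurwitz L)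
    {s : ℝ} (hs : 0 ≤ s) : IsUnit (s • (1 : Matrix (Fin n) (Fin n) ℝ) - L).det := by
  rw [isUnit_iff_ne_zero]
  intro h0
  have hmem : (s : ℂ) ∈ spectrum ℂ (L.map Complex.ofReal) := by
    rw [spectrum.mem_iff, Matrix.isUnit_iff_isUnit_det, isUnit_iff_ne_zero, not_not]
    have : algebraMap ℂ (Matrix (Fin n) (Fin n) ℂ) s - L.map Complex.ofReal
        = Complex.ofRealHom.mapMatrix (s • (1 : Matrix (Fin n) (Fin n) ℝ) - L) := by
      ext i j
      by_cases hij : i = j <;>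
        simp [hij, Matrix.algebraMap_matrix_apply]
    rw [this, ← RingHom.map_det, h0, map_zero]
  have := h _ hmem
  simp at this
  linarith

/-- A nonnegative solution `v` of `(s - L) v = 1` with `L` Metzler is positive. -/
theorem IsMetzler.strongLT_of_nonneg {L : Matrix (Fin n) (Fin n) ℝ} (hL : IsMetzler L) {s : ℝ}
    {v : Fin n → ℝ} (hv : 0 ≤ v)
    (h : (s • (1 : Matrix (Fin n) (Fin n) ℝ) - L) *ᵥ v = 1) : StrongLT 0 v := by
  intro j
  refine lt_of_le_of_ne (hv j) fun h0 => ?_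
  have h1 := congrFun h j
  have h2 := hL.mulVec_apply_le hv (j := j) h0
  rw [Matrix.sub_mulVec, Matrix.smul_mulVec, Matrix.one_mulVec] at h1
  simp only [Pi.sub_apply, Pi.smul_apply, smul_eq_mul, Pi.one_apply, ← h0, Pi.zero_apply,
    Matrix.mulVec_zero] at h1 h2
  linarith

/-- Continuation in `s`: the solution of `(s - L) v = 1` depends continuously on `s ≥ 0`, because no
such `s` is an eigenvalue. It is nonnegative for one large `s = S`. Nonnegativity is a closed
condition that self-improves to strict positivity, so it persists down to `s = 0`. -/
theorem IsHurwitz.exists_strongLT_mulVec_eq {L : Matrix (Fin n) (Fin n) ℝ} (h : IsHurwitz L)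
    (hL : IsMetzler L) : ∃ v : Fin n → ℝ, StrongLT 0 v ∧ L *ᵥ v = -1 := by
  let B : ℝ → Matrix (Fin n) (Fin n) ℝ := fun s => s • 1 - L
  have hB : Continuous B := by fun_prop
  let v : ℝ → Fin n → ℝ := fun s => (B s)⁻¹ *ᵥ 1
  have hBv : ∀ s, 0 ≤ s → B s *ᵥ v s = 1 := fun s hs => by
    simp only [v, Matrix.mulVec_mulVec]
    rw [Matrix.mul_nonsing_inv _ (h.isUnit_det_smul_one_sub hs), Matrix.one_mulVec]
  have hvc : ContinuousOn v (Ici 0) := by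
    have : v = fun s => ((B s).det)⁻¹ • ((B s).adjugate *ᵥ 1) := by
      funext s
      simp only [v, Matrix.inv_def, Ring.inverse_eq_inv', Matrix.smul_mulVec]
    rw [this]
    refine ContinuousOn.smul (ContinuousOn.inv₀ hB.matrix_det.continuousOn fun s hs =>
      (h.isUnit_det_smul_one_sub hs).ne_zero) ?_
    exact (hB.matrix_adjugate.matrix_mulVec continuous_const).continuousOn
  obtain ⟨S, hS0, hS⟩ : ∃ S : ℝ, 0 ≤ S ∧ ∀ j, (L *ᵥ 1) j < S := by
    refine ⟨∑ j, |(L *ᵥ 1) j| + 1, by positivity, fun j => ?_⟩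
    have := Finset.single_le_sum (f := fun j => |(L *ᵥ 1) j|) (fun i _ => abs_nonneg _)
      (Finset.mem_univ j)
    have := le_abs_self ((L *ᵥ 1) j)
    linarith
  have hvS : 0 ≤ v S := by
    -- `S` exceeds every row sum of `L`, so the shifted matrix maps the all-ones vector to a
    -- negative one.
    refine IsMetzler.nonneg_of_mulVec_nonpos (L := L - S • 1) (v := 1) ?_ (fun j => by simp)
      ?_ ?_
    · intro j l hjl
      simpa [Matrix.one_apply_ne hjl] using hL j l hjl
    · intro j
      rw [Matrix.sub_mulVec, Matrix.smul_mulVec, Matrix.one_mulVec]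
      simpa using hS j
    · have : L - S • 1 = - B S := by simp [B]
      rw [this, Matrix.neg_mulVec, hBv S hS0]
      intro j; simp
  have key : Icc 0 S ⊆ {s | 0 ≤ v s} := by
    refine IsClosed.Icc_subset_of_forall_exists_lt ?_ hvS ?_
    · have := (hvc.mono (Icc_subset_Ici_self : Icc 0 S ⊆ Ici 0)).preimage_isClosed_of_isClosed
        isClosed_Icc (isClosed_Ici (a := (0 : Fin n → ℝ)))
      rwa [inter_comm] at this
    · rintro s ⟨hs, hs0, hsS⟩ y hy
      have hpos := hL.strongLT_of_nonneg hs (hBv s hs0.le)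
      have hat : ContinuousAt v s := hvc.continuousAt (Ici_mem_nhds hs0)
      have hev : ∀ᶠ r in 𝓝 s, 0 ≤ v r := by
        have : ∀ᶠ r in 𝓝 s, ∀ j, 0 < v r j := by
          rw [eventually_all]
          intro j
          exact (continuousAt_pi.1 hat j).eventually (lt_mem_nhds (hpos j))
        filter_upwards [this] with r hr j using (hr j).le
      have hev2 := hev.filter_mono (nhdsWithin_le_nhds (s := Iio s))
      obtain ⟨r, hr, hr2⟩ := (hev2.and (Ico_mem_nhdsLT hy)).exists
      exact ⟨r, hr, hr2⟩
  have h0 : 0 ≤ v 0 := key ⟨le_rfl, hS0⟩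
  refine ⟨v 0, hL.strongLT_of_nonneg h0 (hBv 0 le_rfl), ?_⟩
  have := hBv 0 le_rfl
  simp only [B, zero_smul, zero_sub, Matrix.neg_mulVec] at this
  exact neg_eq_iff_eq_neg.1 this

theorem IsHurwitz.isUnit_det {L : Matrix (Fin n) (Fin n) ℝ} (h : IsHurwitz L) :
    IsUnit L.det := by
  have := h.isUnit_det_smul_one_sub le_rfl
  rw [zero_smul, zero_sub, Matrix.det_neg] at this
  exact isUnit_of_mul_isUnit_right this

theorem IsHurwitz.mulVec_inv_mulVec {L : Matrix (Fin n) (Fin n) ℝ} (h : IsHurwitz L)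
    (u : Fin n → ℝ) : L *ᵥ (L⁻¹ *ᵥ u) = u := by
  rw [Matrix.mulVec_mulVec, Matrix.mul_nonsing_inv _ h.isUnit_det, Matrix.one_mulVec]

theorem IsHurwitz.inv_mulVec_mulVec {L : Matrix (Fin n) (Fin n) ℝ} (h : IsHurwitz L)
    (u : Fin n → ℝ) : L⁻¹ *ᵥ (L *ᵥ u) = u := by
  rw [Matrix.mulVec_mulVec, Matrix.nonsing_inv_mul _ h.isUnit_det, Matrix.one_mulVec]

theorem IsHurwitz.nonneg_of_mulVec_nonpos {L : Matrix (Fin n) (Fin n) ℝ} (h : IsHurwitz L)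
    (hL : IsMetzler L) {u : Fin n → ℝ} (hu : L *ᵥ u ≤ 0) : 0 ≤ u := by
  obtain ⟨v, hv, hLv⟩ := h.exists_strongLT_mulVec_eq hL
  exact hL.nonneg_of_mulVec_nonpos hv (fun j => by simp [hLv]) hu

theorem IsHurwitz.neg_inv_mulVec_nonneg {L : Matrix (Fin n) (Fin n) ℝ} (h : IsHurwitz L)
    (hL : IsMetzler L) {u : Fin n → ℝ} (hu : 0 ≤ u) : 0 ≤ -(L⁻¹ *ᵥ u) := by
  refine h.nonneg_of_mulVec_nonpos hL ?_
  rw [Matrix.mulVec_neg, h.mulVec_inv_mulVec]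
  exact neg_nonpos.2 hu

theorem IsHurwitz.neg_inv_mulVec_mono {L : Matrix (Fin n) (Fin n) ℝ} (h : IsHurwitz L)
    (hL : IsMetzler L) {u v : Fin n → ℝ} (huv : u ≤ v) : -(L⁻¹ *ᵥ u) ≤ -(L⁻¹ *ᵥ v) := by
  have := h.neg_inv_mulVec_nonneg hL (sub_nonneg.2 huv)
  rw [Matrix.mulVec_sub] at this
  rw [← sub_nonneg]
  convert this using 1
  abel

theorem metzlerPart_le_lamMat [NeZero N] (V : Matrix (Fin n) (Fin n) ℂ)
    (A : Fin N → Matrix (Fin n) (Fin n) ℝ) (i : Fin N) (j l : Fin n) :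
    metzlerPart (V⁻¹ * (A i).map Complex.ofReal * V) j l ≤ lamMat V A j l :=
  Finset.le_sup' (fun i => metzlerPart (V⁻¹ * (A i).map Complex.ofReal * V) j l)
    (Finset.mem_univ i)

theorem isMetzler_lamMat [NeZero N] (V : Matrix (Fin n) (Fin n) ℂ)
    (A : Fin N → Matrix (Fin n) (Fin n) ℝ) : IsMetzler (lamMat V A) := by
  intro j l hjl
  refine le_trans ?_ (metzlerPart_le_lamMat V A 0 j l)
  simp [metzlerPart, hjl]

theorem pVec_eq_sup (L : Matrix (Fin n) (Fin n) ℝ) (c : Fin n → ℝ) :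
    pVec L c = (-(L *ᵥ c)) ⊔ 0 := by
  funext j
  simp only [pVec, Pi.sup_apply, Pi.zero_apply]
  split_ifs with h
  · exact (sup_eq_left.2 h.le).symm
  · exact (sup_eq_right.2 (not_lt.1 h)).symm

/-! ### The maps `T_γ`, their iterates, and admissible `γ`: parts (a) and (c). -/

section

variable {L : Matrix (Fin n) (Fin n) ℝ} {δ : (Fin n → ℝ) → (Fin n → ℝ)} {β : Fin n → ℝ}

theorem IsHurwitz.mapsTo_tMap (h : IsHurwitz L) (hL : IsMetzler L) (hδ : IsCNI δ)
    {γ : Fin n → ℝ} (hγ : 0 ≤ γ) : MapsTo (tMap L δ γ) (orthant n) (orthant n) := fun _ hx =>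
  add_nonneg (h.neg_inv_mulVec_nonneg hL (hδ.mapsTo hx)) hγ

theorem IsHurwitz.monotoneOn_tMap (h : IsHurwitz L) (hL : IsMetzler L) (hδ : IsCNI δ)
    (γ : Fin n → ℝ) : MonotoneOn (tMap L δ γ) (orthant n) := fun _ hx _ hy hxy =>
  add_le_add_left (h.neg_inv_mulVec_mono hL (hδ.monotoneOn hx hy hxy)) γ

theorem IsHurwitz.iterate_tMap_nonneg (h : IsHurwitz L) (hL : IsMetzler L) (hδ : IsCNI δ)
    (hβ : 0 ≤ β) (m : ℕ) : 0 ≤ (tMap L δ 0)^[m] β :=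
  (h.mapsTo_tMap hL hδ le_rfl).iterate m hβ

theorem IsHurwitz.iterate_tMap_succ_le (h : IsHurwitz L) (hL : IsMetzler L) (hδ : IsCNI δ)
    (hβ : 0 ≤ β) (hTβ : tMap L δ 0 β ≤ β) (m : ℕ) :
    (tMap L δ 0)^[m + 1] β ≤ (tMap L δ 0)^[m] β := by
  induction m with
  | zero => simpa using hTβ
  | succ m ih =>
    rw [Function.iterate_succ_apply' _ (m + 1), Function.iterate_succ_apply' _ m]
    rw [Function.iterate_succ_apply' _ m] at ih
    have h1 := h.iterate_tMap_nonneg hL hδ hβ m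
    exact h.monotoneOn_tMap hL hδ 0 (h.mapsTo_tMap hL hδ le_rfl h1) h1 ih

theorem IsHurwitz.exists_tendsto_iterate_tMap (h : IsHurwitz L) (hL : IsMetzler L)
    (hδ : IsCNI δ) (hβ : 0 ≤ β) (hTβ : tMap L δ 0 β ≤ β) :
    ∃ b, Tendsto (fun m : ℕ => (tMap L δ 0)^[m] β) atTop (𝓝 b) ∧ 0 ≤ b := by
  have hnonneg := h.iterate_tMap_nonneg hL hδ hβ
  have hanti : Antitone fun m : ℕ => (tMap L δ 0)^[m] β :=
    antitone_nat_of_succ_le (h.iterate_tMap_succ_le hL hδ hβ hTβ)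
  have hlim := tendsto_atTop_ciInf hanti ⟨0, by rintro _ ⟨m, rfl⟩; exact hnonneg m⟩
  exact ⟨_, hlim, ge_of_tendsto' hlim hnonneg⟩

/-- Write `γ = -L⁻¹(-L γ)` and enlarge `-L γ` to its positive part. The initial bound in (b) thus
lies below the supersolution on the right. -/
theorem IsHurwitz.tMap_le_neg_inv_mulVec (h : IsHurwitz L) (hL : IsMetzler L)
    (γ : Fin n → ℝ) : tMap L δ γ β ≤ -(L⁻¹ *ᵥ (δ β + (-(L *ᵥ γ)) ⊔ 0)) := by
  have h1 := h.neg_inv_mulVec_mono hL (le_sup_left : -(L *ᵥ γ) ≤ (-(L *ᵥ γ)) ⊔ 0)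
  rw [Matrix.mulVec_neg, neg_neg, h.inv_mulVec_mulVec] at h1
  rw [Matrix.mulVec_add, neg_add]
  exact add_le_add_right h1 _

/-- If the positive part of `-L c` vanished, then `L(-c) ≤ 0` would force `-c ≥ 0`. -/
theorem IsHurwitz.pVec_ne_zero [NeZero n] (h : IsHurwitz L) (hL : IsMetzler L)
    {c : Fin n → ℝ} (hc : StrongLT 0 c) : pVec L c ≠ 0 := by
  intro h0
  rw [pVec_eq_sup, sup_eq_right] at h0
  have h1 := h.nonneg_of_mulVec_nonpos hL (u := -c) (by rwa [Matrix.mulVec_neg]) 0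
  have h2 := hc 0
  simp only [Pi.neg_apply, Pi.zero_apply] at h1 h2
  linarith

theorem IsHurwitz.pSupport_nonempty [NeZero n] (h : IsHurwitz L) (hL : IsMetzler L)
    {c : Fin n → ℝ} (hc : StrongLT 0 c) : (pSupport L c).Nonempty := by
  by_contra hne
  rw [Finset.not_nonempty_iff_eq_empty, pSupport, Finset.filter_eq_empty_iff] at hne
  refine h.pVec_ne_zero hL hc ?_
  have h1 : L⁻¹ *ᵥ pVec L c = 0 := by
    funext j
    have := hne (Finset.mem_univ j)
    simpa using this
  rw [← h.mulVec_inv_mulVec (pVec L c), h1, Matrix.mulVec_zero]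

theorem IsHurwitz.neg_inv_mulVec_pVec_pos (h : IsHurwitz L) (hL : IsMetzler L)
    {c : Fin n → ℝ} {j : Fin n} (hj : j ∈ pSupport L c) : 0 < (-(L⁻¹ *ᵥ pVec L c)) j := by
  have h1 := h.neg_inv_mulVec_nonneg hL (u := pVec L c)
    (by rw [pVec_eq_sup]; exact le_sup_right) j
  exact lt_of_le_of_ne h1 (Finset.mem_filter.1 hj).2.symm

theorem add_inv_mulVec_pos (hTβ : StrongLT (tMap L δ 0 β) β) (j : Fin n) :
    0 < (β + L⁻¹ *ᵥ δ β) j := by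
  have := hTβ j
  simp only [tMap, Pi.add_apply, Pi.neg_apply, Pi.zero_apply] at this ⊢
  linarith

theorem IsHurwitz.epsBar_pos (h : IsHurwitz L) (hL : IsMetzler L)
    (hTβ : StrongLT (tMap L δ 0 β) β) {c : Fin n → ℝ} (hne : (pSupport L c).Nonempty) :
    0 < epsBar L δ β c hne := by
  rw [epsBar, Finset.lt_inf'_iff]
  exact fun j hj => div_pos (add_inv_mulVec_pos hTβ j) (h.neg_inv_mulVec_pVec_pos hL hj)

theorem IsHurwitz.admissible_smul (h : IsHurwitz L) (hL : IsMetzler L)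
    (hTβ : StrongLT (tMap L δ 0 β) β) {c : Fin n → ℝ} (hne : (pSupport L c).Nonempty)
    {ε : ℝ} (hε : 0 < ε) (hlt : ε < epsBar L δ β c hne) : Admissible L δ β (ε • c) := by
  -- Positive homogeneity makes the condition on `ε` linear in each coordinate; coordinates outside
  -- `pSupport` impose no bound on `ε`.
  have hp : (-(L *ᵥ (ε • c))) ⊔ 0 = ε • pVec L c := by
    rw [pVec_eq_sup, Matrix.mulVec_smul]
    funext j
    simp only [Pi.sup_apply, Pi.neg_apply, Pi.smul_apply, smul_eq_mul, Pi.zero_apply]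
    rw [mul_max_of_nonneg _ _ hε.le, mul_zero, mul_neg]
  intro j
  rw [hp, Matrix.mulVec_add, Matrix.mulVec_smul]
  have h1 := add_inv_mulVec_pos hTβ j
  simp only [Pi.add_apply, Pi.neg_apply, Pi.smul_apply, smul_eq_mul] at h1 ⊢
  by_cases hj : j ∈ pSupport L c
  · have h2 := (Finset.lt_inf'_iff hne).1 hlt j hj
    rw [lt_div_iff₀ (h.neg_inv_mulVec_pVec_pos hL hj)] at h2
    simp only [Pi.add_apply, Pi.neg_apply] at h2
    linarith
  · have h2 : (L⁻¹ *ᵥ pVec L c) j = 0 := by simpa [pSupport] using hj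
    rw [h2]
    linarith

end

/-! ### Absolutely continuous functions and scalar differential inequalities. -/

theorem _root_.LipschitzWith.comp_absolutelyContinuousOnInterval {X Y : Type*}
    [PseudoMetricSpace X] [PseudoMetricSpace Y] {K : NNReal} {g : X → Y} (hg : LipschitzWith K g)
    {f : ℝ → X} {a b : ℝ} (hf : AbsolutelyContinuousOnInterval f a b) :
    AbsolutelyContinuousOnInterval (fun t => g (f t)) a b := by
  refine squeeze_zero (fun E => Finset.sum_nonneg fun i _ => dist_nonneg) (fun E => ?_)
    (by simpa using Tendsto.const_mul (K : ℝ) hf)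
  rw [Finset.mul_sum]
  exact Finset.sum_le_sum fun i _ => hg.dist_le_mul _ _

theorem _root_.AbsolutelyContinuousOnInterval.le_of_ae_deriv_nonpos {f : ℝ → ℝ} {a b : ℝ}
    (hab : a ≤ b) (hf : AbsolutelyContinuousOnInterval f a b)
    (h : ∀ᵐ t, t ∈ Icc a b → deriv f t ≤ 0) : f b ≤ f a := by
  have h1 : 0 ≤ ∫ t in a..b, -deriv f t := by
    refine intervalIntegral.integral_nonneg_of_ae_restrict hab ?_
    rw [EventuallyLE, ae_restrict_iff' measurableSet_Icc]
    filter_upwards [h] with t ht hmem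
    simpa using ht hmem
  rw [intervalIntegral.integral_neg, hf.integral_deriv_eq_sub] at h1
  linarith

/-- A differential inequality `f' ≤ -r f` forces exponential decay. -/
theorem _root_.AbsolutelyContinuousOnInterval.exp_mul_le_exp_mul {f : ℝ → ℝ} {a b r : ℝ}
    (hab : a ≤ b) (hf : AbsolutelyContinuousOnInterval f a b)
    (h : ∀ᵐ t, t ∈ Icc a b → ∀ d, HasDerivAt f d t → d ≤ -r * f t) :
    Real.exp (r * b) * f b ≤ Real.exp (r * a) * f a := by
  have he : AbsolutelyContinuousOnInterval (fun t => Real.exp (r * t)) a b :=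
    ContDiffOn.absolutelyContinuousOnInterval (by fun_prop)
  refine (he.fun_mul hf).le_of_ae_deriv_nonpos hab ?_
  filter_upwards [h, hf.ae_differentiableAt] with t ht hdiff hmem
  have hd := (hdiff (by rwa [uIcc_of_le hab])).hasDerivAt
  have hexp : HasDerivAt (fun t => Real.exp (r * t)) (Real.exp (r * t) * r) t := by
    simpa using ((hasDerivAt_id t).const_mul r).exp
  rw [(hexp.fun_mul hd).deriv]
  have := mul_le_mul_of_nonneg_left (ht hmem _ hd) (Real.exp_pos (r * t)).le
  linarith

/-! ### Moduli in the transformed coordinates, the excess, and the perturbation bounds. -/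

/-- The map `x ↦ B x` on real vectors, for a complex matrix `B`. -/
noncomputable def mulVecCLM {m : ℕ} (B : Matrix (Fin n) (Fin m) ℂ) :
    (Fin m → ℝ) →L[ℝ] (Fin n → ℂ) :=
  LinearMap.toContinuousLinearMap
    ((B.mulVecLin.restrictScalars ℝ) ∘ₗ (Complex.ofRealCLM.toLinearMap.compLeft (Fin m)))

theorem mulVecCLM_apply {m : ℕ} (B : Matrix (Fin n) (Fin m) ℂ) (x : Fin m → ℝ) :
    mulVecCLM B x = B *ᵥ fun l => (x l : ℂ) := rfl

theorem absMulVec_eq {m : ℕ} (B : Matrix (Fin n) (Fin m) ℂ) (x : Fin m → ℝ) (j : Fin n) :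
    absMulVec B x j = ‖mulVecCLM B x j‖ := rfl

/-- The weighted amount by which the moduli of `z` exceed the bound `η`. -/
noncomputable def excess (η v : Fin n → ℝ) (z : Fin n → ℂ) : ℝ :=
  ‖fun j => max ((‖z j‖ - η j) / v j) 0‖

theorem excess_nonneg (η v : Fin n → ℝ) (z : Fin n → ℂ) : 0 ≤ excess η v z := norm_nonneg _

theorem norm_le_add_excess {η v : Fin n → ℝ} (hv : StrongLT 0 v) (z : Fin n → ℂ) (j : Fin n) :
    ‖z j‖ ≤ η j + excess η v z * v j := by
  have hvj : 0 < v j := hv j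
  have h1 : (‖z j‖ - η j) / v j ≤ excess η v z :=
    (le_max_left _ 0).trans ((Real.le_norm_self _).trans
      (norm_le_pi_norm (fun j => max ((‖z j‖ - η j) / v j) 0) j))
  rw [div_le_iff₀ hvj] at h1
  linarith

/-- A maximum over finitely many coordinates is attained; positivity rules out the truncation at
`0`. -/
theorem exists_norm_eq_add_excess {η v : Fin n → ℝ} (hv : StrongLT 0 v) {z : Fin n → ℂ}
    (h : 0 < excess η v z) : ∃ j, ‖z j‖ = η j + excess η v z * v j := by
  by_contra! hne
  refine lt_irrefl (excess η v z) ((pi_norm_lt_iff h).2 fun j => ?_)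
  have hvj : 0 < v j := hv j
  have hlt := lt_of_le_of_ne (norm_le_add_excess hv z j) (hne j)
  rw [Real.norm_of_nonneg (le_max_right _ _), max_lt_iff, div_lt_iff₀ hvj]
  exact ⟨by linarith, h⟩

theorem excess_eq_zero {η v : Fin n → ℝ} (hv : StrongLT 0 v) {z : Fin n → ℂ}
    (h : ∀ j, ‖z j‖ ≤ η j) : excess η v z = 0 := by
  have : (fun j => max ((‖z j‖ - η j) / v j) 0) = 0 := by
    funext j
    exact max_eq_right (div_nonpos_of_nonpos_of_nonneg (sub_nonpos.2 (h j)) (hv j).le)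
  rw [excess, this, norm_zero]

/-- Makes the excess absolutely continuous along a trajectory, so that an almost-everywhere
derivative bound suffices. -/
theorem exists_lipschitzWith_excess (η : Fin n → ℝ) {v : Fin n → ℝ} (hv : StrongLT 0 v) :
    ∃ K, LipschitzWith K (excess η v) := by
  refine ⟨∑ j, (v j).toNNReal⁻¹, LipschitzWith.of_dist_le_mul fun z z' => ?_⟩
  refine (dist_norm_norm_le _ _).trans ?_
  refine (pi_norm_le_iff_of_nonneg (by positivity)).2 fun j => ?_
  have hvj : 0 < v j := hv j
  have h1 : ‖max ((‖z j‖ - η j) / v j) 0 - max ((‖z' j‖ - η j) / v j) 0‖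
      ≤ (v j)⁻¹ * dist z z' := by
    rw [Real.norm_eq_abs]
    refine (abs_max_sub_max_le_abs _ _ _).trans ?_
    rw [← sub_div, abs_div, abs_of_pos hvj, div_eq_inv_mul]
    refine mul_le_mul_of_nonneg_left ?_ (by positivity)
    rw [sub_sub_sub_cancel_right]
    refine (abs_norm_sub_norm_le _ _).trans ?_
    rw [← dist_eq_norm]
    exact dist_le_pi_dist z z' j
  refine h1.trans (mul_le_mul_of_nonneg_right ?_ dist_nonneg)
  have h2 := Finset.single_le_sum (f := fun j => (v j).toNNReal⁻¹) (fun i _ => zero_le)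
    (Finset.mem_univ j)
  have h3 := NNReal.coe_le_coe.2 h2
  simpa [Real.coe_toNNReal _ hvj.le] using h3

/-- For a unimodular `φ` that turns `z j` into its modulus, the real part of `φ (B z)_j` is at
most `(L |z|)_j` if `L` dominates the Metzler part of `B`. -/
theorem re_mul_mulVec_le {B : Matrix (Fin n) (Fin n) ℂ} {L : Matrix (Fin n) (Fin n) ℝ}
    (hBL : ∀ j l, metzlerPart B j l ≤ L j l) {z : Fin n → ℂ} {j : Fin n} {φ : ℂ}
    (hφ : ‖φ‖ = 1) (hφz : φ * z j = ‖z j‖) :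
    (φ * (B *ᵥ z) j).re ≤ (L *ᵥ fun l => ‖z l‖) j := by
  simp only [Matrix.mulVec, dotProduct, Finset.mul_sum, Complex.re_sum]
  refine Finset.sum_le_sum fun l _ => ?_
  refine le_trans ?_ (mul_le_mul_of_nonneg_right (hBL j l) (norm_nonneg _))
  by_cases h : j = l
  · subst h
    have : φ * (B j j * z j) = B j j * ‖z j‖ := by rw [← hφz]; ring
    rw [this, Complex.re_mul_ofReal]
    simp [metzlerPart]
  · refine (Complex.re_le_norm _).trans ?_
    simp [metzlerPart, h, hφ]

theorem absMulVec_le_absMat_mulVec {m : ℕ} (B : Matrix (Fin n) (Fin m) ℂ) {z : Fin m → ℂ}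
    {u : Fin m → ℝ} (h : ∀ l, ‖z l‖ ≤ u l) (j : Fin n) : ‖(B *ᵥ z) j‖ ≤ (absMat B *ᵥ u) j := by
  simp only [Matrix.mulVec, dotProduct, absMat, Matrix.map_apply]
  refine (norm_sum_le _ _).trans (Finset.sum_le_sum fun l _ => ?_)
  rw [norm_mul]
  exact mul_le_mul_of_nonneg_left (h l) (norm_nonneg _)

theorem absMulVec_le_psi [NeZero N] {k : Fin N → ℕ} (V : Matrix (Fin n) (Fin n) ℂ)
    (H : ∀ i, Matrix (Fin n) (Fin (k i)) ℝ) (dl : ∀ i, (Fin n → ℝ) → (Fin (k i) → ℝ))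
    (x : Fin n → ℝ) (i : Fin N) {w : Fin (k i) → ℝ} (hw : |w| ≤ dl i (absMat V *ᵥ x)) :
    absMulVec (V⁻¹ * (H i).map Complex.ofReal) w ≤ psi V H dl x := by
  intro j
  refine le_trans ?_ (Finset.le_sup' (fun i => sSup ((fun w : Fin (k i) → ℝ =>
    absMulVec (V⁻¹ * (H i).map Complex.ofReal) w j) '' {w | |w| ≤ dl i (absMat V *ᵥ x)}))
    (Finset.mem_univ i))
  -- The explicit upper bound is needed because a real `sSup` of an unbounded set is the default
  -- value `0`.
  refine le_csSup ⟨(absMat (V⁻¹ * (H i).map Complex.ofReal) *ᵥ dl i (absMat V *ᵥ x)) j, ?_⟩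
    ⟨w, hw, rfl⟩
  rintro _ ⟨u, hu, rfl⟩
  refine absMulVec_le_absMat_mulVec _ (fun l => ?_) j
  rw [Complex.norm_real]
  exact hu l

theorem delayMax_nonneg (τ : ℝ) (x : ℝ → Fin n → ℝ) (t : ℝ) : 0 ≤ delayMax τ x t := by
  intro j
  refine Real.sSup_nonneg ?_
  rintro _ ⟨s, -, rfl⟩
  exact abs_nonneg _

theorem delayMax_le {V : Matrix (Fin n) (Fin n) ℂ} (hV : IsUnit V) {τ : ℝ} (hτ : 0 ≤ τ)
    {x : ℝ → Fin n → ℝ} {t : ℝ} {ζ : Fin n → ℝ}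
    (h : ∀ s ∈ Icc (t - τ) t, absMulVec V⁻¹ (x s) ≤ ζ) : delayMax τ x t ≤ absMat V *ᵥ ζ := by
  intro j
  refine csSup_le ((nonempty_Icc.2 (by linarith)).image _) ?_
  rintro _ ⟨s, hs, rfl⟩
  have h1 : V *ᵥ mulVecCLM V⁻¹ (x s) = fun l => (x s l : ℂ) := by
    rw [mulVecCLM_apply, Matrix.mulVec_mulVec,
      Matrix.mul_nonsing_inv _ ((Matrix.isUnit_iff_isUnit_det _).1 hV), Matrix.one_mulVec]
  have h2 := absMulVec_le_absMat_mulVec V (z := mulVecCLM V⁻¹ (x s)) (h s hs) j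
  rwa [h1, Complex.norm_real] at h2

theorem absMat_mulVec_nonneg (V : Matrix (Fin n) (Fin n) ℂ) {ζ : Fin n → ℝ} (hζ : 0 ≤ ζ) :
    0 ≤ absMat V *ᵥ ζ := by
  intro j
  simp only [Matrix.mulVec, dotProduct, absMat, Matrix.map_apply]
  exact Finset.sum_nonneg fun l _ => mul_nonneg (norm_nonneg (V j l)) (hζ l)

/-! ### Trajectories: decay of the excess, trapping, and improvement of asymptotic bounds. -/

section

variable {k : Fin N → ℕ} {A : Fin N → Matrix (Fin n) (Fin n) ℝ}
  {H : ∀ i, Matrix (Fin n) (Fin (k i)) ℝ} {dl : ∀ i, (Fin n → ℝ) → (Fin (k i) → ℝ)} {τ : ℝ}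
  {V : Matrix (Fin n) (Fin n) ℂ} {δ : (Fin n → ℝ) → (Fin n → ℝ)}
  {σ : ℝ → Fin N} {w : ∀ i, ℝ → Fin (k i) → ℝ} {x : ℝ → Fin n → ℝ}

theorem IsTrajectory.continuousOn_absMulVec (hx : IsTrajectory A H dl τ σ w x)
    (B : Matrix (Fin n) (Fin n) ℂ) (j : Fin n) :
    ContinuousOn (fun t => absMulVec B (x t) j) (Ici (-τ)) := by
  have h1 : ContinuousOn (fun t => mulVecCLM B (x t)) (Ici (-τ)) :=
    (mulVecCLM B).continuous.comp_continuousOn hx.continuousOn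
  exact (continuousOn_pi.1 h1 j).norm

variable [NeZero N]

theorem IsTrajectory.absMulVec_perturbation_le (hx : IsTrajectory A H dl τ σ w x)
    (hdl : ∀ i, IsCNI (dl i)) (hτ : 0 ≤ τ) (hV : IsUnit V)
    (hψ : ∀ x ∈ orthant n, psi V H dl x ≤ δ x) {ζ : Fin n → ℝ} (hζ : 0 ≤ ζ) {t : ℝ}
    (ht : 0 ≤ t) (h : ∀ s ∈ Icc (t - τ) t, absMulVec V⁻¹ (x s) ≤ ζ) (i : Fin N) :
    absMulVec (V⁻¹ * (H i).map Complex.ofReal) (w i t) ≤ δ ζ := by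
  refine (absMulVec_le_psi V H dl ζ i ?_).trans (hψ ζ hζ)
  exact (hx.bound t ht i).trans ((hdl i).monotoneOn (delayMax_nonneg τ x t)
    (absMat_mulVec_nonneg V hζ) (delayMax_le hV hτ h))

theorem mulVecCLM_inv_rhs (hV : IsUnit V) {m : ℕ} (A : Matrix (Fin n) (Fin n) ℝ)
    (H : Matrix (Fin n) (Fin m) ℝ) (x : Fin n → ℝ) (w : Fin m → ℝ) :
    mulVecCLM V⁻¹ (A *ᵥ x + H *ᵥ w) =
      (V⁻¹ * A.map Complex.ofReal * V) *ᵥ mulVecCLM V⁻¹ x +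
        mulVecCLM (V⁻¹ * H.map Complex.ofReal) w := by
  have h1 : ∀ {p : ℕ} (M : Matrix (Fin n) (Fin p) ℝ) (u : Fin p → ℝ),
      mulVecCLM V⁻¹ (M *ᵥ u) = (V⁻¹ * M.map Complex.ofReal) *ᵥ fun l => (u l : ℂ) := by
    intro p M u
    rw [mulVecCLM_apply, ← Matrix.mulVec_mulVec]
    congr 1
    funext l
    simp [Matrix.mulVec, dotProduct]
  rw [map_add, h1, h1, mulVecCLM_apply, mulVecCLM_apply, Matrix.mulVec_mulVec,
    Matrix.mul_assoc _ V, Matrix.mul_nonsing_inv _ ((Matrix.isUnit_iff_isUnit_det _).1 hV),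
    Matrix.mul_one]

/-- The derivative of the excess along a trajectory, at times where the delayed state is bounded
by `ζ`. -/
theorem IsTrajectory.deriv_excess_le (hx : IsTrajectory A H dl τ σ w x)
    (hdl : ∀ i, IsCNI (dl i)) (hτ : 0 ≤ τ) (hV : IsUnit V)
    (hψ : ∀ x ∈ orthant n, psi V H dl x ≤ δ x) {ζ η v : Fin n → ℝ} (hζ : 0 ≤ ζ) (hη : 0 ≤ η)
    (hηζ : lamMat V A *ᵥ η + δ ζ ≤ 0) (hv : StrongLT 0 v) {r : ℝ}
    (hr : lamMat V A *ᵥ v ≤ -(r • v)) {t : ℝ} (ht : 0 ≤ t)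
    (hζx : ∀ s ∈ Icc (t - τ) t, absMulVec V⁻¹ (x s) ≤ ζ)
    (hode : HasDerivAt x (A (σ t) *ᵥ x t + H (σ t) *ᵥ w (σ t) t) t) {d : ℝ}
    (hd : HasDerivAt (fun s => excess η v (mulVecCLM V⁻¹ (x s))) d t) :
    d ≤ -r * excess η v (mulVecCLM V⁻¹ (x t)) := by
  set L := lamMat V A with hL
  set z : ℝ → Fin n → ℂ := fun s => mulVecCLM V⁻¹ (x s) with hz
  change d ≤ -r * excess η v (z t)
  -- Zero is the global minimum of the excess, so any derivative there vanishes.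
  rcases (excess_nonneg η v (z t)).eq_or_lt with h0 | hpos
  · have hmin : IsLocalMin (fun s => excess η v (z s)) t :=
      Eventually.of_forall fun s => h0.symm.trans_le (excess_nonneg _ _ _)
    rw [hmin.hasDerivAt_eq_zero hd, ← h0, mul_zero]
  obtain ⟨j, hj⟩ := exists_norm_eq_add_excess hv hpos
  have hvj : 0 < v j := hv j
  have hzj : 0 < ‖z t j‖ := by
    rw [hj]
    exact add_pos_of_nonneg_of_pos (hη j) (mul_pos hpos hvj)
  have hzj' : (‖z t j‖ : ℂ) ≠ 0 := by exact_mod_cast hzj.ne'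
  -- Freezing the phase of `z j` at time `t` replaces the modulus by a real-linear function that
  -- lies below it and agrees with it at `t`.
  set φ : ℂ := (starRingEnd ℂ) (z t j) / ‖z t j‖ with hφdef
  have hφ : ‖φ‖ = 1 := by
    rw [hφdef, norm_div, RCLike.norm_conj, Complex.norm_real, norm_norm, div_self hzj.ne']
  have hφz : φ * z t j = ‖z t j‖ := by
    rw [hφdef, div_mul_eq_mul_div, Complex.conj_mul', sq, mul_div_assoc, div_self hzj', mul_one]
  set y := mulVecCLM V⁻¹ (A (σ t) *ᵥ x t + H (σ t) *ᵥ w (σ t) t) with hy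
  have hzd : HasDerivAt z y t := (mulVecCLM V⁻¹).hasFDerivAt.comp_hasDerivAt t hode
  have hzjd : HasDerivAt (fun s => (φ * z s j).re) (φ * y j).re t :=
    Complex.reCLM.hasFDerivAt.comp_hasDerivAt t ((hasDerivAt_pi.1 hzd j).const_mul φ)
  have hgd : HasDerivAt (fun s => excess η v (z s) * v j - (φ * z s j).re)
      (d * v j - (φ * y j).re) t := (hd.mul_const (v j)).sub hzjd
  -- This difference is at least `-η j` everywhere, with equality at `t`. Its zero derivative
  -- identifies `d * v j` with the real part of `φ * y j`.
  have hmin : IsLocalMin (fun s => excess η v (z s) * v j - (φ * z s j).re) t := by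
    refine Eventually.of_forall fun s => ?_
    have h1 : (φ * z s j).re ≤ ‖z s j‖ :=
      (Complex.re_le_norm _).trans (by rw [norm_mul, hφ, one_mul])
    have h2 := norm_le_add_excess (η := η) hv (z s) j
    have h3 : (φ * z t j).re = ‖z t j‖ := by rw [hφz, Complex.ofReal_re]
    simp only
    rw [h3]
    linarith
  have hdeq := hmin.hasDerivAt_eq_zero hgd
  have hB := re_mul_mulVec_le (metzlerPart_le_lamMat V A (σ t)) hφ hφz
  have hw := hx.absMulVec_perturbation_le hdl hτ hV hψ hζ ht hζx (σ t) j
  rw [absMulVec_eq] at hw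
  have hu : (φ * mulVecCLM (V⁻¹ * (H (σ t)).map Complex.ofReal) (w (σ t) t) j).re ≤ δ ζ j :=
    ((Complex.re_le_norm _).trans (by rw [norm_mul, hφ, one_mul])).trans hw
  have hyre : (φ * y j).re ≤ (L *ᵥ fun l => ‖z t l‖) j + δ ζ j := by
    rw [hy, mulVecCLM_inv_rhs hV, Pi.add_apply, mul_add, Complex.add_re]
    exact add_le_add hB hu
  -- The vector `η + excess • v` dominates the moduli and touches them at `j`, so the Metzler
  -- comparison applies in row `j`.
  have hcmp := (isMetzler_lamMat V A).mulVec_apply_le (a := fun l => ‖z t l‖)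
    (b := η + excess η v (z t) • v) (fun l => norm_le_add_excess hv (z t) l) (j := j) hj
  rw [← hL, Matrix.mulVec_add, Matrix.mulVec_smul] at hcmp
  have h1 := hηζ j
  have h2 := mul_le_mul_of_nonneg_left (hr j) hpos.le
  simp only [Pi.add_apply, Pi.smul_apply, Pi.neg_apply, Pi.zero_apply, smul_eq_mul]
    at hcmp h1 h2
  have h3 : d * v j ≤ -r * excess η v (z t) * v j := by linarith
  exact le_of_mul_le_mul_right h3 hvj

theorem IsTrajectory.exp_mul_excess_le (hx : IsTrajectory A H dl τ σ w x)
    (hdl : ∀ i, IsCNI (dl i)) (hτ : 0 ≤ τ) (hV : IsUnit V)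
    (hψ : ∀ x ∈ orthant n, psi V H dl x ≤ δ x) {ζ η v : Fin n → ℝ} (hζ : 0 ≤ ζ) (hη : 0 ≤ η)
    (hηζ : lamMat V A *ᵥ η + δ ζ ≤ 0) (hv : StrongLT 0 v) {r : ℝ}
    (hr : lamMat V A *ᵥ v ≤ -(r • v)) {a b : ℝ} (ha : 0 ≤ a) (hab : a ≤ b)
    (hζx : ∀ s ∈ Icc (a - τ) b, absMulVec V⁻¹ (x s) ≤ ζ) :
    Real.exp (r * b) * excess η v (mulVecCLM V⁻¹ (x b)) ≤
      Real.exp (r * a) * excess η v (mulVecCLM V⁻¹ (x a)) := by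
  obtain ⟨K, hK⟩ := exists_lipschitzWith_excess η hv
  have hac : AbsolutelyContinuousOnInterval x a b := by
    refine (hx.absolutelyContinuous b (ha.trans hab)).mono ?_
    rw [uIcc_of_le hab, uIcc_of_le (ha.trans hab)]
    exact Icc_subset_Icc_left ha
  have hE := (hK.comp (mulVecCLM V⁻¹).lipschitz).comp_absolutelyContinuousOnInterval hac
  refine AbsolutelyContinuousOnInterval.exp_mul_le_exp_mul hab hE ?_
  filter_upwards [hx.ode] with t hode ht d hd
  have ht0 : 0 ≤ t := ha.trans ht.1
  exact hx.deriv_excess_le hdl hτ hV hψ hζ hη hηζ hv hr ht0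
    (fun s hs => hζx s ⟨by linarith [hs.1, ht.1], hs.2.trans ht.2⟩) (hode ht0) hd

/-- A supersolution `η` strictly below `ζ` that bounds the initial data traps the trajectory
below `ζ`. -/
theorem IsTrajectory.absMulVec_le_of_initial (hx : IsTrajectory A H dl τ σ w x)
    (hdl : ∀ i, IsCNI (dl i)) (hτ : 0 ≤ τ) (hV : IsUnit V) (hH : IsHurwitz (lamMat V A))
    (hψ : ∀ x ∈ orthant n, psi V H dl x ≤ δ x) {ζ η : Fin n → ℝ} (hζ : 0 ≤ ζ) (hη : 0 ≤ η)
    (hηζ : lamMat V A *ᵥ η + δ ζ ≤ 0) (hlt : StrongLT η ζ)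
    (hinit : ∀ t, -τ ≤ t → t ≤ 0 → absMulVec V⁻¹ (x t) ≤ η) {t : ℝ} (ht : -τ ≤ t) :
    absMulVec V⁻¹ (x t) ≤ ζ := by
  obtain ⟨v, hv, hLv⟩ := hH.exists_strongLT_mulVec_eq (isMetzler_lamMat V A)
  rcases le_total t 0 with ht0 | ht0
  · exact (hinit t ht ht0).trans hlt.le
  have key : Icc 0 t ⊆ {s | absMulVec V⁻¹ (x s) ≤ ζ} := by
    have hsub : Icc 0 t ⊆ Ici (-τ) := fun s hs => by
      have := hs.1
      simp only [mem_Ici]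
      linarith
    have hcont : ContinuousOn (fun s => absMulVec V⁻¹ (x s)) (Icc 0 t) :=
      continuousOn_pi.2 fun j => (hx.continuousOn_absMulVec V⁻¹ j).mono hsub
    refine IsClosed.Icc_subset_of_forall_mem_nhdsGT_of_Icc_subset ?_ ?_ ?_
    · have := hcont.preimage_isClosed_of_isClosed isClosed_Icc (isClosed_Iic (a := ζ))
      rwa [inter_comm] at this
    · exact (hinit 0 (by linarith) le_rfl).trans hlt.le
    · intro s hs hbd
      -- With rate `0` the excess cannot grow from its initial value zero, so `η` still bounds the
      -- moduli at `s`; since `η ≺ ζ`, continuity carries the bound `ζ` past `s`.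
      have hexc := hx.exp_mul_excess_le hdl hτ hV hψ hζ hη hηζ hv (r := 0)
        (by rw [hLv]; intro j; simp) le_rfl hs.1 (fun q hq => by
          rcases le_total q 0 with hq0 | hq0
          · exact (hinit q (by linarith [hq.1]) hq0).trans hlt.le
          · exact hbd ⟨hq0, hq.2⟩)
      rw [excess_eq_zero hv (z := mulVecCLM V⁻¹ (x 0)) (hinit 0 (by linarith) le_rfl)] at hexc
      simp only [zero_mul, Real.exp_zero, one_mul, mul_zero] at hexc
      have hle : ∀ j, absMulVec V⁻¹ (x s) j < ζ j := fun j => by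
        have h1 := norm_le_add_excess (η := η) hv (mulVecCLM V⁻¹ (x s)) j
        rw [le_antisymm hexc (excess_nonneg _ _ _), zero_mul, add_zero] at h1
        exact lt_of_le_of_lt h1 (hlt j)
      have hev : ∀ᶠ q in 𝓝[>] s, ∀ j, absMulVec V⁻¹ (x q) j < ζ j := by
        rw [eventually_all]
        intro j
        have hs' : s ∈ Ici (-τ) := hsub ⟨hs.1, hs.2.le⟩
        have hw := (hx.continuousOn_absMulVec V⁻¹ j s hs').mono
          (Ioi_subset_Ici hs' : Ioi s ⊆ Ici (-τ))
        exact hw.eventually (gt_mem_nhds (hle j))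
      filter_upwards [hev] with q hq j using (hq j).le
  exact key ⟨ht0, le_rfl⟩

/-- An asymptotic bound `ζ` of a trajectory improves to `T₀ ζ`. -/
theorem IsTrajectory.eventually_le_tMap (hx : IsTrajectory A H dl τ σ w x)
    (hdl : ∀ i, IsCNI (dl i)) (hτ : 0 ≤ τ) (hV : IsUnit V) (hH : IsHurwitz (lamMat V A))
    (hδ : IsCNI δ) (hδc : ContinuousOn δ (orthant n))
    (hψ : ∀ x ∈ orthant n, psi V H dl x ≤ δ x) {ζ : Fin n → ℝ} (hζ : 0 ≤ ζ)
    (hbd : ∀ ε > 0, ∀ᶠ t in atTop, ∀ j, absMulVec V⁻¹ (x t) j ≤ ζ j + ε) :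
    ∀ ε > 0, ∀ᶠ t in atTop, ∀ j,
      absMulVec V⁻¹ (x t) j ≤ tMap (lamMat V A) δ 0 ζ j + ε := by
  intro ε hε
  have hM := isMetzler_lamMat V A
  obtain ⟨v, hv, hLv⟩ := hH.exists_strongLT_mulVec_eq hM
  set L := lamMat V A
  -- As `L v = -1`, this choice gives `L v ≤ -r v`, a genuine decay rate.
  obtain ⟨r, hr0, hr⟩ : ∃ r : ℝ, 0 < r ∧ ∀ j, r * v j ≤ 1 := by
    have h0 : 0 < ∑ j, v j + 1 := by
      have := Finset.sum_nonneg fun j (_ : j ∈ Finset.univ) => (hv j).le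
      linarith
    refine ⟨(∑ j, v j + 1)⁻¹, inv_pos.2 h0, fun j => ?_⟩
    rw [inv_mul_le_iff₀ h0, mul_one]
    have := Finset.single_le_sum (fun i _ => (hv i).le) (Finset.mem_univ j)
    linarith
  -- Continuity of `T₀` at `ζ` within the orthant: half of `ε` pays for enlarging `ζ`, the other
  -- half for the decaying excess.
  obtain ⟨ε', hε', hT⟩ : ∃ ε' > 0, ∀ j,
      tMap L δ 0 (fun j => ζ j + ε') j < tMap L δ 0 ζ j + ε / 2 := by
    have hpath : Tendsto (fun s : ℝ => fun j => ζ j + s) (𝓝[>] 0) (𝓝[orthant n] ζ) := by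
      refine tendsto_nhdsWithin_iff.2 ⟨?_, ?_⟩
      · have : Continuous fun s : ℝ => fun j => ζ j + s := by fun_prop
        have h := this.tendsto 0
        simp only [add_zero] at h
        exact h.mono_left nhdsWithin_le_nhds
      · filter_upwards [self_mem_nhdsWithin] with s hs j
        exact add_nonneg (hζ j) (le_of_lt hs)
    have hc : ContinuousOn (tMap L δ 0) (orthant n) := by
      unfold tMap
      have h1 : Continuous fun u : Fin n → ℝ => L⁻¹ *ᵥ u :=
        continuous_const.matrix_mulVec continuous_id
      exact (h1.comp_continuousOn hδc).neg.add continuousOn_const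
    have hlim := (hc ζ hζ).tendsto.comp hpath
    have hev : ∀ᶠ s : ℝ in 𝓝[>] 0, ∀ j,
        tMap L δ 0 (fun j => ζ j + s) j < tMap L δ 0 ζ j + ε / 2 := by
      rw [eventually_all]
      intro j
      exact (tendsto_pi_nhds.1 hlim j).eventually (gt_mem_nhds (by linarith))
    obtain ⟨s, hs, hs0⟩ := (hev.and self_mem_nhdsWithin).exists
    exact ⟨s, hs0, hs⟩
  obtain ⟨T, hT'⟩ := eventually_atTop.1 (hbd ε' hε')
  set ζ' : Fin n → ℝ := fun j => ζ j + ε'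
  have hζ' : 0 ≤ ζ' := fun j => add_nonneg (hζ j) hε'.le
  set η := tMap L δ 0 ζ' with hηdef
  have hη : 0 ≤ η := hH.mapsTo_tMap hM hδ le_rfl hζ'
  have hηζ : L *ᵥ η + δ ζ' ≤ 0 := by
    rw [hηdef, tMap, add_zero, Matrix.mulVec_neg, hH.mulVec_inv_mulVec, neg_add_cancel]
  -- Adding `τ` puts the whole delay window of every `t ≥ a` after `T`.
  set a := max T 0 + τ
  have ha : 0 ≤ a := add_nonneg (le_max_right _ _) hτ
  set C := Real.exp (r * a) * excess η v (mulVecCLM V⁻¹ (x a))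
  have hdecay : ∀ t, a ≤ t → excess η v (mulVecCLM V⁻¹ (x t)) ≤ Real.exp (-(r * t)) * C := by
    intro t ht
    have h1 := hx.exp_mul_excess_le hdl hτ hV hψ hζ' hη hηζ hv (r := r)
      (by rw [hLv]; exact fun j => neg_le_neg (hr j)) ha ht
      (fun s hs j => hT' s (by
        have := hs.1
        have := le_max_left T 0
        simp only [a] at *
        linarith) j)
    rw [Real.exp_neg, le_inv_mul_iff₀ (Real.exp_pos _)]
    exact h1
  have hzero : Tendsto (fun t : ℝ => Real.exp (-(r * t)) * C) atTop (𝓝 0) := by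
    have h1 : Tendsto (fun t : ℝ => Real.exp (-(r * t))) atTop (𝓝 0) :=
      Real.tendsto_exp_neg_atTop_nhds_zero.comp (tendsto_id.const_mul_atTop hr0)
    simpa using h1.mul_const C
  rw [eventually_all]
  intro j
  have hzj : Tendsto (fun t : ℝ => Real.exp (-(r * t)) * C * v j) atTop (𝓝 0) := by
    simpa using hzero.mul_const (v j)
  filter_upwards [hzj.eventually (gt_mem_nhds (half_pos hε)), eventually_ge_atTop a] with t h1 h2
  have h3 := norm_le_add_excess (η := η) hv (mulVecCLM V⁻¹ (x t)) j
  rw [← absMulVec_eq] at h3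
  have h4 := mul_le_mul_of_nonneg_right (hdecay t h2) (hv j).le
  have h5 := hT j
  linarith

end

/-! ### Parts (b) and (d). -/

section

variable [NeZero N] {k : Fin N → ℕ} {A : Fin N → Matrix (Fin n) (Fin n) ℝ}
  {H : ∀ i, Matrix (Fin n) (Fin (k i)) ℝ} {dl : ∀ i, (Fin n → ℝ) → (Fin (k i) → ℝ)} {τ : ℝ}
  {V : Matrix (Fin n) (Fin n) ℂ} {δ : (Fin n → ℝ) → (Fin n → ℝ)}
  {σ : ℝ → Fin N} {w : ∀ i, ℝ → Fin (k i) → ℝ} {x : ℝ → Fin n → ℝ} {β : Fin n → ℝ}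

theorem IsTrajectory.absMulVec_le_of_admissible (hx : IsTrajectory A H dl τ σ w x)
    (hdl : ∀ i, IsCNI (dl i)) (hτ : 0 ≤ τ) (hV : IsUnit V) (hH : IsHurwitz (lamMat V A))
    (hδ : IsCNI δ) (hψ : ∀ x ∈ orthant n, psi V H dl x ≤ δ x) (hβ : 0 ≤ β)
    {γ : Fin n → ℝ} (hγ : Admissible (lamMat V A) δ β γ)
    (hinit : ∀ t, -τ ≤ t → t ≤ 0 → absMulVec V⁻¹ (x t) ≤ tMap (lamMat V A) δ γ β) {t : ℝ}
    (ht : -τ ≤ t) : absMulVec V⁻¹ (x t) ≤ β := by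
  have hM := isMetzler_lamMat V A
  refine hx.absMulVec_le_of_initial hdl hτ hV hH hψ hβ
    (hH.neg_inv_mulVec_nonneg hM (add_nonneg (hδ.mapsTo hβ) le_sup_right)) ?_ hγ
    (fun s hs hs0 => (hinit s hs hs0).trans (hH.tMap_le_neg_inv_mulVec hM γ)) ht
  -- For this `η`, `Λ η + δ(β)` is exactly minus the positive part of `-Λ γ`. That is why the
  -- admissibility condition uses the positive part.
  rw [Matrix.mulVec_neg, hH.mulVec_inv_mulVec, neg_add_rev, add_assoc, neg_add_cancel, add_zero]
  exact neg_nonpos.2 le_sup_right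

theorem IsTrajectory.limsup_absMulVec_le (hx : IsTrajectory A H dl τ σ w x)
    (hdl : ∀ i, IsCNI (dl i)) (hτ : 0 ≤ τ) (hV : IsUnit V) (hH : IsHurwitz (lamMat V A))
    (hδ : IsCNI δ) (hδc : ContinuousOn δ (orthant n))
    (hψ : ∀ x ∈ orthant n, psi V H dl x ≤ δ x) (hβ : 0 ≤ β) {b : Fin n → ℝ}
    (hb : Tendsto (fun m : ℕ => (tMap (lamMat V A) δ 0)^[m] β) atTop (𝓝 b))
    (hbd : ∀ t, -τ ≤ t → absMulVec V⁻¹ (x t) ≤ β) (j : Fin n) :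
    limsup (fun t => absMulVec V⁻¹ (x t) j) atTop ≤ b j := by
  have hM := isMetzler_lamMat V A
  -- The `ε` form is what reproduces itself under `T₀`: each iterate is only an asymptotic bound,
  -- reached up to arbitrarily small error.
  have hiter : ∀ m : ℕ, ∀ ε > 0, ∀ᶠ t in atTop, ∀ j,
      absMulVec V⁻¹ (x t) j ≤ (tMap (lamMat V A) δ 0)^[m] β j + ε := by
    intro m
    induction m with
    | zero =>
      intro ε hε
      filter_upwards [eventually_ge_atTop (-τ)] with t ht j
      exact (hbd t ht j).trans (le_add_of_nonneg_right hε.le)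
    | succ m ih =>
      rw [Function.iterate_succ_apply']
      exact hx.eventually_le_tMap hdl hτ hV hH hδ hδc hψ (hH.iterate_tMap_nonneg hM hδ hβ m) ih
  refine le_of_forall_pos_le_add fun ε hε => ?_
  have hlt : ∀ᶠ m : ℕ in atTop, (tMap (lamMat V A) δ 0)^[m] β j < b j + ε / 2 :=
    (tendsto_pi_nhds.1 hb j).eventually (gt_mem_nhds (by linarith))
  obtain ⟨m, hm⟩ := hlt.exists
  refine limsup_le_of_le ?_ ?_
  -- The lower bound `0` keeps the real `limsup` from being a default value.
  · exact isCoboundedUnder_le_of_le atTop (x := 0) fun t => norm_nonneg _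
  · filter_upwards [hiter m (ε / 2) (half_pos hε)] with t ht
    linarith [ht j]

end

end SwitchingSystem

theorem mainTheorem1 {n N : ℕ} [NeZero n] [NeZero N] {k : Fin N → ℕ}
    (A : Fin N → Matrix (Fin n) (Fin n) ℝ) (H : ∀ i, Matrix (Fin n) (Fin (k i)) ℝ)
    (dl : ∀ i, (Fin n → ℝ) → (Fin (k i) → ℝ))
    (hdl_cont : ∀ i, ContinuousOn (dl i) (SwitchingSystem.orthant n))
    (hdl_cni : ∀ i, SwitchingSystem.IsCNI (dl i))
    (τ : ℝ) (hτ : 0 ≤ τ)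
    (V : Matrix (Fin n) (Fin n) ℂ) (hV : IsUnit V)
    (L : Matrix (Fin n) (Fin n) ℝ) (hL : L = SwitchingSystem.lamMat V A)
    (hHurwitz : SwitchingSystem.IsHurwitz L)
    (δ : (Fin n → ℝ) → (Fin n → ℝ))
    (hδ_cont : ContinuousOn δ (SwitchingSystem.orthant n))
    (hδ_cni : SwitchingSystem.IsCNI δ)
    (hδ_psi : ∀ x ∈ SwitchingSystem.orthant n, SwitchingSystem.psi V H dl x ≤ δ x)
    (β : Fin n → ℝ) (hβ : 0 ≤ β)
    (hTβ : StrongLT (SwitchingSystem.tMap L δ 0 β) β) :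
    -- the maps `T_γ` are maps of the nonnegative orthant to itself
    (∀ γ, 0 ≤ γ → Set.MapsTo (SwitchingSystem.tMap L δ γ)
      (SwitchingSystem.orthant n) (SwitchingSystem.orthant n)) ∧
    ∃ b : Fin n → ℝ,
      -- (a)
      ((∀ m : ℕ, (SwitchingSystem.tMap L δ 0)^[m + 1] β ≤ (SwitchingSystem.tMap L δ 0)^[m] β) ∧
        Filter.Tendsto (fun m : ℕ => (SwitchingSystem.tMap L δ 0)^[m] β) Filter.atTop (nhds b) ∧
        0 ≤ b) ∧
      -- (b)
      (∀ γ, 0 ≤ γ → SwitchingSystem.Admissible L δ β γ →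
        ∀ σ w x, SwitchingSystem.IsTrajectory A H dl τ σ w x →
          (∀ t, -τ ≤ t → t ≤ 0 →
            SwitchingSystem.absMulVec V⁻¹ (x t) ≤ SwitchingSystem.tMap L δ γ β) →
          ∀ t, -τ ≤ t → SwitchingSystem.absMulVec V⁻¹ (x t) ≤ β) ∧
      -- (c)
      (∀ c : Fin n → ℝ, StrongLT 0 c →
        SwitchingSystem.pVec L c ≠ 0 ∧
        ∃ h : (SwitchingSystem.pSupport L c).Nonempty,
          0 < SwitchingSystem.epsBar L δ β c h ∧
          ∀ ε : ℝ, 0 < ε → ε < SwitchingSystem.epsBar L δ β c h →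
            SwitchingSystem.Admissible L δ β (ε • c)) ∧
      -- (d)
      (∀ σ w x, SwitchingSystem.IsTrajectory A H dl τ σ w x →
        (∀ t, -τ ≤ t → SwitchingSystem.absMulVec V⁻¹ (x t) ≤ β) →
        ∀ j, Filter.limsup (fun t => SwitchingSystem.absMulVec V⁻¹ (x t) j) Filter.atTop ≤ b j) := by
  subst hL
  have hM := SwitchingSystem.isMetzler_lamMat V A
  obtain ⟨b, hb, hb0⟩ := hHurwitz.exists_tendsto_iterate_tMap hM hδ_cni hβ hTβ.le
  refine ⟨fun γ hγ => hHurwitz.mapsTo_tMap hM hδ_cni hγ, b,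
    ⟨hHurwitz.iterate_tMap_succ_le hM hδ_cni hβ hTβ.le, hb, hb0⟩, ?_, ?_, ?_⟩
  · intro γ _ hadm σ w x hx hinit t ht
    exact hx.absMulVec_le_of_admissible hdl_cni hτ hV hHurwitz hδ_cni hδ_psi hβ hadm hinit ht
  · intro c hc
    have hne := hHurwitz.pSupport_nonempty hM hc
    exact ⟨hHurwitz.pVec_ne_zero hM hc, hne, hHurwitz.epsBar_pos hM hTβ hne,
      fun ε hε hlt => hHurwitz.admissible_smul hM hTβ hne hε hlt⟩
  · intro σ w x hx hbd j
    exact hx.limsup_absMulVec_le hdl_cni hτ hV hHurwitz hδ_cni hδ_cont hδ_psi hβ hb hbd j
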